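/- Let $H$ be a real Hilbert space and $F:H\to H$ a monotone operator ($\langle F(u)-F(v),u-v\rangle\ge 0$ for all $u,v$) which is twice Fréchet differentiable. Let $f\in H$ be such that $F(u)=f$ is solvable, and let $y$ be its minimal-norm solution, $y\ne 0$. Let $C_1>1$, $0<\zeta\le 1$, $C:=\frac{C_1+1}{2}$. Let $u_0\in H$ and $R>0$, and let $\|F'(u)\|\le M_1$, $\|F''(u)\|\le M_2$ for all $u\in B(u_0,R):=\{u:\|u-u_0\|\le R\}$. Put $c_0:=\frac{M_2}{2}$ and $c_1:=\|y\|\left(1+\frac{1}{C-1}\right)$. Let $a_n=\frac{d}{(c+n)^b}$, $n\ge 0$, with $c\ge 1$, $0<b\le\frac14$, $d>0$, let $(\alpha_n)_{n\ge0}$ and $\tilde\alpha$ be such that $$0<\tilde\alpha\le\alpha_n\le\frac{2}{a_n^2+(M_1+a_n)^2}\qquad(n\ge 0),$$ and let $d$ be sufficiently large that, for some (fixed) $\lambda>0$ and all $n\ge 0$, $$\frac{a_n}{a_{n+1}}\le 2,\quad \frac{M_1}{\lambda}\le\|y\|,\quad \frac{c_0(M_1+a_0)}{\lambda}\le\frac12,\quad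 \frac{a_n^2}{\lambda}-\frac{\tilde\alpha a_n^4}{2\lambda}+\frac{a_n-a_{n+1}}{a_{n+1}}c_1\le\frac{a_{n+1}^2}{\lambda}.$$ Let $R$ be so large that $R\ge \frac{a_0^2}{\lambda}+\|u_0\|+\|y\|\frac{C+1}{C-1}$. For $\delta>0$ call $f_\delta\in H$ admissible if $\|f_\delta-f\|\le\delta$, $\|f_\delta-F(0)\|\le \frac{a_0^3}{\lambda}$, and $\|u_0-V_0\|\le\frac{\|F(0)-f_\delta\|}{a_0}$, where $V_0$ solves $F(V_0)+a_0V_0=f_\delta$. For such $f_\delta$ let $u_n=u_{n}(f_\delta)$ be defined by $$u_{n+1}=u_n-\alpha_nA_n^*\big[F(u_n)+a_nu_n-f_\delta\big],\qquad A_n:=F'(u_n)+a_nI,$$ starting from $u_0$. An index $n_\delta\ge 0$ is called a stopping index if $$\|F(u_{n_\delta})-f_\delta\|\le C_1\delta^\zeta,\qquad C_1\delta^\zeta<\|F(u_n)-f_\delta\|\quad\forall\, n<n_\delta .$$ (i) There is $\delta_0>0$ such that for all $\delta\in(0,\delta_0)$ and all admissible $f_\delta$ there exists a unique stopping index $n_\delta$.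 (ii) Let $\delta_m>0$, $\delta_m\to0$, let $f_{\delta_m}$ be admissible for $\delta_m$, and let $n_m$ be a stopping index for $f_{\delta_m}$, for every $m$. If $(n_m)$ is bounded and $(n_{m_j})_j$ is a convergent subsequence, then $u_{n_{m_j}}(f_{\delta_{m_j}})$ converges as $j\to\infty$ to some $\tilde u$ with $F(\tilde u)=f$. If $n_m\to\infty$ and $\zeta\in(0,1)$, then $\|u_{n_m}(f_{\delta_m})-y\|\to0$. -/

import Mathlib

open Filter Topology
open scoped InnerProductSpace

/-- Monotonicity of a (nonlinear) operator on a real inner product space. -/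
def MonotoneOperator {H : Type*} [NormedAddCommGroup H] [InnerProductSpace ℝ H]
    (F : H → H) : Prop :=
  ∀ u v : H, 0 ≤ ⟪F u - F v, u - v⟫_ℝ

/-- `y` is a minimal-norm solution of `F u = f`. -/
def IsMinimalNormSolution {H : Type*} [NormedAddCommGroup H]
    (F : H → H) (f y : H) : Prop :=
  F y = f ∧ ∀ u : H, F u = f → ‖y‖ ≤ ‖u‖

/-- The regularization parameters `a_n = d / (c + n) ^ b`. -/
noncomputable def regParam (d c b : ℝ) (n : ℕ) : ℝ :=
  d / (c + (n : ℝ)) ^ b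

/-- The iterates `u_{n+1} = u_n - α_n A_n^* (F(u_n) + a_n u_n - g)`,
`A_n = F'(u_n) + a_n I`, started at `u₀`, for the data `g`. -/
noncomputable def gradIter {H : Type*} [NormedAddCommGroup H] [InnerProductSpace ℝ H]
    [CompleteSpace H] (F : H → H) (a α : ℕ → ℝ) (g u₀ : H) : ℕ → H
  | 0 => u₀
  | n + 1 =>
    gradIter F a α g u₀ n -
      α n • (ContinuousLinearMap.adjoint
          (fderiv ℝ F (gradIter F a α g u₀ n) + a n • ContinuousLinearMap.id ℝ H))
        (F (gradIter F a α g u₀ n) + a n • gradIter F a α g u₀ n - g)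

/-- The conditions linking the sequence `a_n` and the number `lam` to the constants
`M₁`, `c₀`, `c₁`, `αt` (the lower bound of the step sizes) and `‖y‖`. -/
structure ParamConditions (a : ℕ → ℝ) (lam M₁ c₀ c₁ αt normy : ℝ) : Prop where
  lam_pos : 0 < lam
  ratio : ∀ n, a n / a (n + 1) ≤ 2
  deriv_bound : M₁ / lam ≤ normy
  nonlin_bound : c₀ * (M₁ + a 0) / lam ≤ 1 / 2
  step : ∀ n, a n ^ 2 / lam - αt * a n ^ 4 / (2 * lam)
      + (a n - a (n + 1)) / a (n + 1) * c₁ ≤ a (n + 1) ^ 2 / lam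

/-- The conditions on the noisy data `g` of noise level `δ`: `‖g - f‖ ≤ δ`,
`‖g - F(0)‖ ≤ a_0 ^ 3 / lam`, and the initial guess satisfies
`‖u₀ - V_0‖ ≤ ‖F(0) - g‖ / a_0`, where `V_0` solves `F(V) + a_0 V = g`. -/
structure AdmissibleData {H : Type*} [NormedAddCommGroup H] [InnerProductSpace ℝ H]
    (F : H → H) (a₀ lam : ℝ) (f u₀ : H) (δ : ℝ) (g : H) : Prop where
  noise : ‖g - f‖ ≤ δ
  size : ‖g - F 0‖ ≤ a₀ ^ 3 / lam
  init : ∃ V : H, F V + a₀ • V - g = 0 ∧ ‖u₀ - V‖ ≤ ‖F 0 - g‖ / a₀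

/-- `n` is the discrepancy-principle stopping index of the sequence `u` for the data `g` of
noise level `δ`: the first index at which `‖F(u_n) - g‖ ≤ C₁ δ ^ ζ`. -/
def IsStoppingIndex {H : Type*} [NormedAddCommGroup H]
    (F : H → H) (u : ℕ → H) (g : H) (C₁ ζ δ : ℝ) (n : ℕ) : Prop :=
  ‖F (u n) - g‖ ≤ C₁ * δ ^ ζ ∧ ∀ k < n, C₁ * δ ^ ζ < ‖F (u k) - g‖

/-!
The iteration follows the Tikhonov–Browder path: for data `g` let `V n` be the regularized solution,
the unique solution of `F V + a n • V = g`. It exists since `F + a • id` has open range by the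
inverse function theorem and closed range by monotonicity
(`MonotoneOperator.exists_add_smul_eq`).

Write `z n = ‖u n - V n‖`. The linearized gradient step contracts by `1 - α n * a n ^ 2`
(`norm_id_sub_smul_adjoint_mul_self_le`), the Taylor remainder of `F` contributes a term of order
`z n ^ 2`, and `V n - V (n + 1)` is bounded by `(a n - a (n + 1)) / a (n + 1) * ‖V n‖`. The
parameter conditions are what is needed to propagate `z n ≤ a n ^ 2 / lam` by induction, as long
as `‖V n‖ ≤ c₁` (`MonotoneOperator.gradIter_tracks`).

Let `N` be the first index at which the residual `a N * ‖V N‖` of the regularized solution is at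
most `C * δ ^ ζ`. Before `N` the noise is dominated by the parameter, `(C - 1) * δ ^ ζ ≤ a n * ‖y‖`,
which gives `‖V n‖ ≤ c₁` and hence tracking up to and including `N`. Since `‖V N‖ ≥ ‖V 0‖` is
bounded away from zero for small noise, `a N` is of order `δ ^ ζ`; the tracking error changes the
residual by a term of order `a N ^ 2`, so `‖F (u N) - g‖ ≤ C₁ * δ ^ ζ` for small `δ`
(`MonotoneOperator.exists_index_norm_residual_le`). Thus the stopping index exists and is at most
`N`.

If the stopping indices are eventually equal to some `N`, convergence follows from continuous
dependence of the `N`-th iterate on the data. If they tend to infinity, the distance of the stopped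
iterate to `y` is at most the sum of the tracking error `a n ^ 2 / lam`, the data error
`δ / a n = O(δ ^ (1 - ζ))`, and the distance to `y` of the regularized solution for exact data,
which tends to zero (`MonotoneOperator.tendsto_regularized`).
-/

/-! ### Monotone operators and their regularizations -/

section Monotone

variable {H : Type*} [NormedAddCommGroup H] [InnerProductSpace ℝ H] {F : H → H}

/-- Adding `a • id` to a monotone operator makes it expanding by the factor `a`. -/
lemma MonotoneOperator.mul_norm_sub_le (hF : MonotoneOperator F) {a : ℝ} (u v : H) :
    a * ‖u - v‖ ≤ ‖(F u + a • u) - (F v + a • v)‖ := by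
  rcases eq_or_ne u v with rfl | huv
  · simp
  have hpos : 0 < ‖u - v‖ := norm_pos_iff.2 (sub_ne_zero.2 huv)
  have h1 : a * ‖u - v‖ ^ 2 ≤ ⟪(F u + a • u) - (F v + a • v), u - v⟫_ℝ := by
    have : (F u + a • u) - (F v + a • v) = (F u - F v) + a • (u - v) := by
      rw [smul_sub]; abel
    rw [this, inner_add_left, real_inner_smul_left, real_inner_self_eq_norm_sq]
    linarith [hF u v]
  have h2 := real_inner_le_norm ((F u + a • u) - (F v + a • v)) (u - v)
  refine le_of_mul_le_mul_right ?_ hpos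
  nlinarith

/-- The derivative of a monotone operator is a positive (not necessarily symmetric) operator. -/
lemma MonotoneOperator.inner_fderiv_nonneg (hF : MonotoneOperator F) {u : H}
    (hd : DifferentiableAt ℝ F u) (h : H) : 0 ≤ ⟪fderiv ℝ F u h, h⟫_ℝ := by
  have hline : HasDerivAt (fun t : ℝ => u + t • h) h 0 := by
    simpa using ((hasDerivAt_id (0 : ℝ)).smul_const h).const_add u
  have hcomp : HasDerivAt (fun t : ℝ => F (u + t • h)) (fderiv ℝ F u h) 0 := by
    have h0 : HasFDerivAt F (fderiv ℝ F u) (u + (0 : ℝ) • h) := by simpa using hd.hasFDerivAt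
    exact h0.comp_hasDerivAt 0 hline
  have hφ : HasDerivAt (fun t : ℝ => ⟪F (u + t • h), h⟫_ℝ) ⟪fderiv ℝ F u h, h⟫_ℝ 0 := by
    simpa using hcomp.inner ℝ (hasDerivAt_const (0 : ℝ) h)
  have hmono : Monotone (fun t : ℝ => ⟪F (u + t • h), h⟫_ℝ) := by
    intro s t hst
    rcases hst.eq_or_lt with rfl | hlt
    · exact le_rfl
    have h1 := hF (u + t • h) (u + s • h)
    have h2 : (u + t • h) - (u + s • h) = (t - s) • h := by rw [sub_smul]; abel
    rw [h2, real_inner_smul_right, inner_sub_left] at h1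
    have h3 := nonneg_of_mul_nonneg_right h1 (sub_pos.2 hlt)
    simpa using h3
  rw [← hφ.deriv]
  exact hmono.deriv_nonneg

/-- An operator bounded below in the sense of quadratic forms is onto (Lax–Milgram). -/
lemma ContinuousLinearMap.range_eq_top_of_mul_sq_le_inner [CompleteSpace H] (A : H →L[ℝ] H)
    {a : ℝ} (ha : 0 < a) (hA : ∀ x, a * ‖x‖ ^ 2 ≤ ⟪A x, x⟫_ℝ) : A.range = ⊤ := by
  let B : H →L[ℝ] H →L[ℝ] ℝ := (innerSL ℝ).comp A
  have hB : IsCoercive B := ⟨a, ha, fun x => by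
    have := hA x
    simp only [B, ContinuousLinearMap.comp_apply, innerSL_apply_apply]
    nlinarith⟩
  have hAB : A = InnerProductSpace.continuousLinearMapOfBilin (𝕜 := ℝ) B := by
    ext v
    exact InnerProductSpace.unique_continuousLinearMapOfBilin B (fun w => by simp [B])
  rw [hAB]
  exact hB.range_eq_top

/-- If `F` is monotone and continuously differentiable, then `F + a • id` is onto for every
`a > 0`. Its range is open by the inverse function theorem, and closed because the map is
expanding. -/
lemma MonotoneOperator.exists_add_smul_eq [CompleteSpace H] (hF : MonotoneOperator F)
    (hd : Differentiable ℝ F) (hd' : Continuous (fderiv ℝ F)) {a : ℝ} (ha : 0 < a) (g : H) :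
    ∃ V, F V + a • V = g := by
  set G : H → H := fun u => F u + a • u with hG
  have hGcont : Continuous G := hd.continuous.add (continuous_const_smul a)
  have hopen : IsOpen (Set.range G) := by
    refine IsOpenMap.isOpen_range (isOpenMap_iff_nhds_le.2 fun u => ?_)
    have hFs : HasStrictFDerivAt F (fderiv ℝ F u) u :=
      hasStrictFDerivAt_of_hasFDerivAt_of_continuousAt
        (Eventually.of_forall fun v => (hd v).hasFDerivAt) hd'.continuousAt
    have hGs : HasStrictFDerivAt G (fderiv ℝ F u + a • ContinuousLinearMap.id ℝ H) u :=
      hFs.add ((hasStrictFDerivAt_id u).const_smul a)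
    refine (hGs.map_nhds_eq_of_surj ?_).ge
    refine ContinuousLinearMap.range_eq_top_of_mul_sq_le_inner _ ha fun x => ?_
    have := hF.inner_fderiv_nonneg (hd u) x
    simp only [add_apply, smul_apply,
      ContinuousLinearMap.id_apply, inner_add_left, real_inner_smul_left,
      real_inner_self_eq_norm_sq]
    linarith
  have hclosed : IsClosed (Set.range G) := by
    refine isClosed_of_closure_subset fun z hz => ?_
    obtain ⟨w, hw, hwz⟩ := mem_closure_iff_seq_limit.1 hz
    choose x hx using hw
    have hxc : CauchySeq x := by
      rw [Metric.cauchySeq_iff]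
      intro ε hε
      obtain ⟨N, hN⟩ := Metric.cauchySeq_iff.1 hwz.cauchySeq (a * ε) (by positivity)
      refine ⟨N, fun m hm n hn => ?_⟩
      have h1 := hN m hm n hn
      rw [dist_eq_norm, ← hx m, ← hx n] at h1
      rw [dist_eq_norm]
      exact lt_of_mul_lt_mul_left ((hF.mul_norm_sub_le (x m) (x n)).trans_lt h1) ha.le
    obtain ⟨x₀, hx₀⟩ := cauchySeq_tendsto_of_complete hxc
    refine ⟨x₀, tendsto_nhds_unique ((hGcont.tendsto x₀).comp hx₀) ?_⟩
    simpa [Function.comp_def, hx] using hwz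
  have huniv := IsClopen.eq_univ ⟨hclosed, hopen⟩ (Set.range_nonempty G)
  have : g ∈ Set.range G := huniv ▸ Set.mem_univ g
  exact this

/-- The regularized solution depends on the data with Lipschitz constant `1 / a`. -/
lemma MonotoneOperator.mul_norm_sub_le_of_data (hF : MonotoneOperator F) {a : ℝ} {V W g g' : H}
    (hV : F V + a • V = g) (hW : F W + a • W = g') : a * ‖V - W‖ ≤ ‖g - g'‖ := by
  simpa [hV, hW] using hF.mul_norm_sub_le (a := a) V W

/-- Dependence of the regularized solution on the parameter. -/
lemma MonotoneOperator.mul_norm_sub_le_of_param (hF : MonotoneOperator F) {a b : ℝ} {V W g : H}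
    (hab : b ≤ a) (hV : F V + a • V = g) (hW : F W + b • W = g) :
    b * ‖V - W‖ ≤ (a - b) * ‖V‖ := by
  refine (hF.mul_norm_sub_le (a := b) V W).trans ?_
  have : F V + b • V - (F W + b • W) = -((a - b) • V) := by
    rw [hW, ← hV, sub_smul]; abel
  rw [this, norm_neg, norm_smul, Real.norm_of_nonneg (sub_nonneg.2 hab)]

/-- The basic inequality comparing the regularized solutions for two parameters. -/
lemma MonotoneOperator.inner_regularized (hF : MonotoneOperator F) {a b : ℝ} {V W g : H}
    (hV : F V + a • V = g) (hW : F W + b • W = g) :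
    a * ‖V‖ ^ 2 + b * ‖W‖ ^ 2 ≤ (a + b) * ⟪V, W⟫_ℝ := by
  have h := hF V W
  have h1 : F V - F W = b • W - a • V := by
    rw [eq_sub_of_add_eq hV, eq_sub_of_add_eq hW]; abel
  rw [h1] at h
  simp only [inner_sub_left, inner_sub_right, real_inner_smul_left,
    real_inner_self_eq_norm_sq, real_inner_comm V W] at h
  nlinarith

/-- The norm of the regularized solution grows as the parameter decreases, and its increments
are controlled by those of the squared norm. -/
lemma MonotoneOperator.norm_sub_sq_le (hF : MonotoneOperator F) {a b : ℝ} {V W g : H}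
    (hb : 0 < b) (hab : b ≤ a) (hV : F V + a • V = g) (hW : F W + b • W = g) :
    ‖V - W‖ ^ 2 ≤ ‖W‖ ^ 2 - ‖V‖ ^ 2 := by
  have h := hF.inner_regularized hV hW
  have h0 : (a + b) * ‖V - W‖ ^ 2 ≤ (a - b) * (‖W‖ ^ 2 - ‖V‖ ^ 2) := by
    rw [norm_sub_sq_real]; nlinarith
  have h1 : 0 ≤ ‖W‖ ^ 2 - ‖V‖ ^ 2 := by
    rcases hab.eq_or_lt with rfl | hlt
    · have h2 : ‖V - W‖ ^ 2 ≤ 0 := by nlinarith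
      have h3 : V = W := by
        rw [← sub_eq_zero, ← norm_eq_zero]; exact pow_eq_zero_iff two_ne_zero |>.1
          (le_antisymm h2 (by positivity))
      simp [h3]
    · exact nonneg_of_mul_nonneg_right
        ((mul_nonneg (by linarith) (sq_nonneg ‖V - W‖)).trans h0)
        (sub_pos.2 hlt)
  refine le_of_mul_le_mul_left (h0.trans ?_) (by linarith : 0 < a + b)
  nlinarith

lemma MonotoneOperator.norm_le_norm_of_param_le (hF : MonotoneOperator F) {a b : ℝ} {V W g : H}
    (hb : 0 < b) (hab : b ≤ a) (hV : F V + a • V = g) (hW : F W + b • W = g) :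
    ‖V‖ ≤ ‖W‖ := by
  have h := hF.norm_sub_sq_le hb hab hV hW
  exact le_of_sq_le_sq (by nlinarith [sq_nonneg ‖V - W‖]) (norm_nonneg _)

lemma MonotoneOperator.norm_sq_le_inner (hF : MonotoneOperator F) {a : ℝ} (ha : 0 < a)
    {V y : H} (hV : F V + a • V = F y) : ‖V‖ ^ 2 ≤ ⟪V, y⟫_ℝ := by
  have h := hF.inner_regularized (b := 0) hV (by simp : F y + (0 : ℝ) • y = F y)
  exact le_of_mul_le_mul_left (by linarith) ha

/-- For exact data the regularized solution is no longer than any solution. -/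
lemma MonotoneOperator.norm_le_of_solution (hF : MonotoneOperator F) {a : ℝ} (ha : 0 < a)
    {V y : H} (hV : F V + a • V = F y) : ‖V‖ ≤ ‖y‖ := by
  have h1 := hF.norm_sq_le_inner ha hV
  have h2 := real_inner_le_norm V y
  rcases (norm_nonneg V).eq_or_lt with h0 | h0
  · rw [← h0]; positivity
  · exact le_of_mul_le_mul_left (by nlinarith) h0

/-- As the parameters decrease to zero, the regularized solutions for exact data converge to the
minimal-norm solution. Their squared norms increase and are bounded, which makes the sequence
Cauchy; no weak compactness is needed. -/
lemma MonotoneOperator.tendsto_regularized [CompleteSpace H] (hF : MonotoneOperator F)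
    (hc : Continuous F) {f y : H} (hy : IsMinimalNormSolution F f y) {a : ℕ → ℝ}
    (ha : ∀ n, 0 < a n) (hanti : Antitone a) (hlim : Tendsto a atTop (𝓝 0)) {V : ℕ → H}
    (hV : ∀ n, F (V n) + a n • V n = f) : Tendsto V atTop (𝓝 y) := by
  have hle : ∀ n, ‖V n‖ ≤ ‖y‖ := fun n => hF.norm_le_of_solution (ha n) ((hV n).trans hy.1.symm)
  have hmono : Monotone fun n => ‖V n‖ ^ 2 := fun m n hmn =>
    pow_le_pow_left₀ (norm_nonneg _)
      (hF.norm_le_norm_of_param_le (ha n) (hanti hmn) (hV m) (hV n)) 2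
  have hbdd : BddAbove (Set.range fun n => ‖V n‖ ^ 2) :=
    ⟨‖y‖ ^ 2, by rintro _ ⟨n, rfl⟩; exact pow_le_pow_left₀ (norm_nonneg _) (hle n) 2⟩
  have hsq := (tendsto_atTop_ciSup hmono hbdd).cauchySeq
  have hVc : CauchySeq V := by
    rw [Metric.cauchySeq_iff']
    intro ε hε
    obtain ⟨N, hN⟩ := Metric.cauchySeq_iff'.1 hsq (ε ^ 2) (by positivity)
    refine ⟨N, fun n hn => ?_⟩
    have h1 := hF.norm_sub_sq_le (ha n) (hanti hn) (hV N) (hV n)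
    have h2 := (le_abs_self _).trans_lt (Real.dist_eq _ _ ▸ hN n hn)
    rw [dist_comm, dist_eq_norm]
    exact lt_of_pow_lt_pow_left₀ 2 hε.le (h1.trans_lt h2)
  obtain ⟨z, hz⟩ := cauchySeq_tendsto_of_complete hVc
  have hFz : F z = f := by
    have h1 : Tendsto (fun n => F (V n) + a n • V n) atTop (𝓝 (F z + (0 : ℝ) • z)) :=
      ((hc.tendsto z).comp hz).add (hlim.smul hz)
    simp only [hV, zero_smul, add_zero] at h1
    exact tendsto_nhds_unique h1 tendsto_const_nhds
  have hin : ‖z‖ ^ 2 ≤ ⟪z, y⟫_ℝ :=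
    le_of_tendsto_of_tendsto' (hz.norm.pow 2) (hz.inner tendsto_const_nhds)
      fun n => hF.norm_sq_le_inner (ha n) ((hV n).trans hy.1.symm)
  have hyz : ‖y‖ ≤ ‖z‖ := hy.2 z hFz
  have h0 : ‖z - y‖ ^ 2 ≤ 0 := by
    rw [norm_sub_sq_real]
    nlinarith [norm_nonneg y]
  have h1 : z = y := by
    rw [← sub_eq_zero, ← norm_eq_zero]
    exact pow_eq_zero_iff two_ne_zero |>.1 (le_antisymm h0 (by positivity))
  exact h1 ▸ hz

end Monotone

/-! ### Calculus estimates and one gradient step -/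

section Step

variable {H : Type*} [NormedAddCommGroup H] [InnerProductSpace ℝ H]

/-- The quadratic Taylor estimate with the sharp constant `M / 2`. -/
lemma Convex.norm_sub_sub_fderiv_le {E G : Type*} [NormedAddCommGroup E] [NormedSpace ℝ E]
    [NormedAddCommGroup G] [NormedSpace ℝ G] {F : E → G} {s : Set E} (hs : Convex ℝ s)
    (hF : Differentiable ℝ F) (hF' : Differentiable ℝ (fderiv ℝ F)) {M : ℝ}
    (hM : ∀ u ∈ s, ‖fderiv ℝ (fderiv ℝ F) u‖ ≤ M) {u v : E} (hu : u ∈ s) (hv : v ∈ s) :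
    ‖F v - F u - fderiv ℝ F u (v - u)‖ ≤ M / 2 * ‖v - u‖ ^ 2 := by
  set h := v - u with hh
  have hline : ∀ t : ℝ, HasDerivAt (fun t : ℝ => u + t • h) h t := fun t => by
    simpa using ((hasDerivAt_id t).smul_const h).const_add u
  have hder : ∀ t : ℝ, HasDerivAt (fun t : ℝ => F (u + t • h) - F u - t • fderiv ℝ F u h)
      (fderiv ℝ F (u + t • h) h - fderiv ℝ F u h) t := fun t => by
    have h1 := (hF (u + t • h)).hasFDerivAt.comp_hasDerivAt t (hline t)
    have h2 := (h1.sub_const (F u)).fun_sub ((hasDerivAt_id t).smul_const (fderiv ℝ F u h))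
    simpa using h2
  have hB : ∀ t : ℝ, HasDerivAt (fun t : ℝ => M / 2 * ‖h‖ ^ 2 * t ^ 2) (M * ‖h‖ ^ 2 * t) t :=
    fun t => ((hasDerivAt_pow 2 t).const_mul (M / 2 * ‖h‖ ^ 2)).congr_deriv
      (by push_cast; ring)
  have hbound : ∀ t ∈ Set.Ico (0 : ℝ) 1,
      ‖fderiv ℝ F (u + t • h) h - fderiv ℝ F u h‖ ≤ M * ‖h‖ ^ 2 * t := by
    intro t ht
    have hmem : u + t • h ∈ s := by
      have := hs.add_smul_sub_mem hu hv ⟨ht.1, ht.2.le⟩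
      simpa [hh] using this
    have h1 := hs.norm_image_sub_le_of_norm_fderiv_le (fun x _ => hF' x) hM hu hmem
    have h2 : ‖u + t • h - u‖ = t * ‖h‖ := by
      rw [add_sub_cancel_left, norm_smul, Real.norm_of_nonneg ht.1]
    rw [h2] at h1
    rw [← sub_apply]
    calc _ ≤ ‖fderiv ℝ F (u + t • h) - fderiv ℝ F u‖ * ‖h‖ := ContinuousLinearMap.le_opNorm _ _
      _ ≤ M * (t * ‖h‖) * ‖h‖ := by gcongr
      _ = _ := by ring
  have key := image_norm_le_of_norm_deriv_right_le_deriv_boundary (a := 0) (b := 1)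
    (fun t _ => (hder t).continuousAt.continuousWithinAt)
    (fun t _ => (hder t).hasDerivWithinAt) (by simp) hB hbound
    (Set.right_mem_Icc.2 zero_le_one)
  simpa [hh] using key

/-- If the quadratic form of `A` is at least `a` and `‖A‖ ≤ L`, then for step sizes up to
`2 / (a² + L²)` the gradient step `I - α A* A` contracts by the factor `1 - α a²`: its
spectrum lies in `[1 - α L², 1 - α a²]`. -/
lemma norm_id_sub_smul_adjoint_mul_self_le [CompleteSpace H] (A : H →L[ℝ] H) {a L α : ℝ}
    (ha : 0 < a) (haL : a ≤ L) (hA : ∀ x, a * ‖x‖ ^ 2 ≤ ⟪A x, x⟫_ℝ) (hL : ‖A‖ ≤ L) (hα : 0 ≤ α)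
    (hα' : α ≤ 2 / (a ^ 2 + L ^ 2)) (x : H) :
    ‖x - α • ContinuousLinearMap.adjoint A (A x)‖ ≤ (1 - α * a ^ 2) * ‖x‖ := by
  set T : H →L[ℝ] H :=
    ContinuousLinearMap.id ℝ H - α • (ContinuousLinearMap.adjoint A).comp A with hT
  have hTin : ∀ z w, ⟪T z, w⟫_ℝ = ⟪z, w⟫_ℝ - α * ⟪A z, A w⟫_ℝ := fun z w => by
    simp [hT, inner_sub_left, real_inner_smul_left, ContinuousLinearMap.adjoint_inner_left]
  have hsymm : T.IsSymmetric := fun z w => by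
    show ⟪T z, w⟫_ℝ = ⟪z, T w⟫_ℝ
    rw [hTin, real_inner_comm (T w) z, hTin, real_inner_comm z w, real_inner_comm (A z)]
  have hαL : α * (a ^ 2 + L ^ 2) ≤ 2 := (le_div_iff₀ (by positivity)).1 hα'
  have hα1 : 0 ≤ 1 - α * a ^ 2 := by
    have : a ^ 2 ≤ L ^ 2 := pow_le_pow_left₀ ha.le haL 2
    nlinarith
  have hnorm : ‖T‖ ≤ 1 - α * a ^ 2 := by
    rw [ContinuousLinearMap.norm_eq_iSup_rayleighQuotient T hsymm]
    refine ciSup_le fun z => ?_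
    rcases eq_or_ne z 0 with rfl | hz
    · simpa using hα1
    have hz' : 0 < ‖z‖ := norm_pos_iff.2 hz
    have hlow : a * ‖z‖ ≤ ‖A z‖ := by
      have := (hA z).trans (real_inner_le_norm _ _)
      exact le_of_mul_le_mul_right (by nlinarith) hz'
    have hup : ‖A z‖ ≤ L * ‖z‖ := A.le_of_opNorm_le hL z
    have hlow2 : a ^ 2 * ‖z‖ ^ 2 ≤ ‖A z‖ ^ 2 := by
      rw [← mul_pow]; exact pow_le_pow_left₀ (by positivity) hlow 2
    have hup2 : ‖A z‖ ^ 2 ≤ L ^ 2 * ‖z‖ ^ 2 := by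
      rw [← mul_pow]; exact pow_le_pow_left₀ (by positivity) hup 2
    have hval : T.rayleighQuotient z = (‖z‖ ^ 2 - α * ‖A z‖ ^ 2) / ‖z‖ ^ 2 := by
      simp only [ContinuousLinearMap.rayleighQuotient, ContinuousLinearMap.reApplyInnerSelf_apply,
        hTin, real_inner_self_eq_norm_sq, RCLike.re_to_real]
    rw [hval, abs_le, le_div_iff₀ (by positivity), div_le_iff₀ (by positivity)]
    constructor
    · nlinarith [mul_le_mul_of_nonneg_left hup2 hα, sq_nonneg ‖z‖]
    · nlinarith [mul_le_mul_of_nonneg_left hlow2 hα]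
  exact T.le_of_opNorm_le hnorm x

end Step

/-! ### Tracking the regularized solutions -/

section Iteration

variable {H : Type*} [NormedAddCommGroup H] [InnerProductSpace ℝ H] [CompleteSpace H] {F : H → H}

/-- One gradient step towards the regularized solution `V`: linear contraction plus a quadratic
error from the Taylor remainder of `F`. -/
lemma MonotoneOperator.norm_gradStep_sub_le (hmono : MonotoneOperator F)
    (hF : Differentiable ℝ F) (hF' : Differentiable ℝ (fderiv ℝ F)) {s : Set H} (hs : Convex ℝ s)
    {M₁ M₂ : ℝ} (hM₁ : ∀ u ∈ s, ‖fderiv ℝ F u‖ ≤ M₁)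
    (hM₂ : ∀ u ∈ s, ‖fderiv ℝ (fderiv ℝ F) u‖ ≤ M₂) {a α : ℝ} (ha : 0 < a) (hα : 0 ≤ α)
    (hα' : α ≤ 2 / (a ^ 2 + (M₁ + a) ^ 2)) {u V g : H} (hu : u ∈ s) (hVs : V ∈ s)
    (hV : F V + a • V = g) :
    ‖u - α • (ContinuousLinearMap.adjoint (fderiv ℝ F u + a • ContinuousLinearMap.id ℝ H))
        (F u + a • u - g) - V‖ ≤
      (1 - α * a ^ 2) * ‖u - V‖ + α * ((M₁ + a) * (M₂ / 2 * ‖u - V‖ ^ 2)) := by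
  have hM₁0 : 0 ≤ M₁ := (norm_nonneg _).trans (hM₁ u hu)
  set A : H →L[ℝ] H := fderiv ℝ F u + a • ContinuousLinearMap.id ℝ H with hA
  set K : H := F V - F u - fderiv ℝ F u (V - u) with hK
  have hKle : ‖K‖ ≤ M₂ / 2 * ‖u - V‖ ^ 2 := by
    rw [norm_sub_rev u V]
    exact hs.norm_sub_sub_fderiv_le hF hF' hM₂ hu hVs
  have hAin : ∀ x, a * ‖x‖ ^ 2 ≤ ⟪A x, x⟫_ℝ := fun x => by
    have := hmono.inner_fderiv_nonneg (hF u) x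
    simp only [hA, add_apply, smul_apply, ContinuousLinearMap.id_apply, inner_add_left,
      real_inner_smul_left, real_inner_self_eq_norm_sq]
    linarith
  have hAle : ‖A‖ ≤ M₁ + a := by
    refine (norm_add_le _ _).trans (add_le_add (hM₁ u hu) ?_)
    rw [norm_smul, Real.norm_of_nonneg ha.le]
    exact mul_le_of_le_one_right ha.le ContinuousLinearMap.norm_id_le
  have hres : F u + a • u - g = A (u - V) - K := by
    rw [← hV, hA, hK]
    simp only [add_apply, smul_apply, ContinuousLinearMap.id_apply, map_sub]
    abel
  have hsplit : u - α • ContinuousLinearMap.adjoint A (F u + a • u - g) - V =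
      ((u - V) - α • ContinuousLinearMap.adjoint A (A (u - V))) +
        α • ContinuousLinearMap.adjoint A K := by
    rw [hres, map_sub, smul_sub]; abel
  rw [hsplit]
  refine (norm_add_le _ _).trans (add_le_add ?_ ?_)
  · exact norm_id_sub_smul_adjoint_mul_self_le A ha (by linarith) hAin hAle hα hα' _
  · rw [norm_smul, Real.norm_of_nonneg hα]
    refine mul_le_mul_of_nonneg_left ?_ hα
    refine (ContinuousLinearMap.le_opNorm _ _).trans ?_
    rw [LinearIsometryEquiv.norm_map]
    exact mul_le_mul hAle hKle (norm_nonneg _) (by linarith)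

/-- As long as the regularized solutions stay bounded by `c₁`, the iterates follow them within
`a n ^ 2 / lam`. The bound `r` for one more regularized solution keeps all points involved in the
ball where the derivatives of `F` are controlled. -/
lemma MonotoneOperator.gradIter_tracks (hmono : MonotoneOperator F)
    (hF : Differentiable ℝ F) (hF' : Differentiable ℝ (fderiv ℝ F)) {u₀ : H} {R M₁ M₂ : ℝ}
    (hM₁ : ∀ u ∈ Metric.closedBall u₀ R, ‖fderiv ℝ F u‖ ≤ M₁)
    (hM₂ : ∀ u ∈ Metric.closedBall u₀ R, ‖fderiv ℝ (fderiv ℝ F) u‖ ≤ M₂)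
    {a α : ℕ → ℝ} {lam c₁ αt k r : ℝ} (ha : ∀ n, 0 < a n) (hanti : Antitone a)
    (hparam : ParamConditions a lam M₁ (M₂ / 2) c₁ αt k)
    (hR : a 0 ^ 2 / lam + ‖u₀‖ + r ≤ R) (hαt : 0 < αt) (hα : ∀ n, αt ≤ α n)
    (hα' : ∀ n, α n ≤ 2 / (a n ^ 2 + (M₁ + a n) ^ 2)) {g : H} {V : ℕ → H}
    (hV : ∀ n, F (V n) + a n • V n = g) (hinit : ‖u₀ - V 0‖ ≤ a 0 ^ 2 / lam) {N : ℕ}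
    (hV₁ : ∀ n < N, ‖V n‖ ≤ c₁) (hVr : ∀ n ≤ N, ‖V n‖ ≤ r) {n : ℕ} (hn : n ≤ N) :
    ‖gradIter F a α g u₀ n - V n‖ ≤ a n ^ 2 / lam ∧
      gradIter F a α g u₀ n ∈ Metric.closedBall u₀ R ∧ V n ∈ Metric.closedBall u₀ R := by
  have hlam := hparam.lam_pos
  have hVR : ∀ n ≤ N, V n ∈ Metric.closedBall u₀ R := fun n hn => by
    rw [mem_closedBall_iff_norm]
    have : 0 ≤ a 0 ^ 2 / lam := by positivity
    linarith [norm_sub_le (V n) u₀, hVr n hn]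
  have hball : ∀ n ≤ N, ‖gradIter F a α g u₀ n - V n‖ ≤ a n ^ 2 / lam →
      gradIter F a α g u₀ n ∈ Metric.closedBall u₀ R := fun n hn h => by
    have h1 : a n ^ 2 / lam ≤ a 0 ^ 2 / lam := by
      gcongr
      · exact (ha n).le
      · exact hanti n.zero_le
    have h2 : gradIter F a α g u₀ n - u₀ = (gradIter F a α g u₀ n - V n) + (V n - u₀) := by abel
    rw [mem_closedBall_iff_norm, h2]
    linarith [norm_add_le (gradIter F a α g u₀ n - V n) (V n - u₀), norm_sub_le (V n) u₀,
      hVr n hn]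
  suffices h : ‖gradIter F a α g u₀ n - V n‖ ≤ a n ^ 2 / lam from ⟨h, hball n hn h, hVR n hn⟩
  induction n with
  | zero => exact hinit
  | succ n ih =>
    have hnN : n ≤ N := by omega
    have hz := ih hnN
    have hu := hball n hnN hz
    have hM₁0 : 0 ≤ M₁ := (norm_nonneg _).trans (hM₁ _ hu)
    have hM₂0 : 0 ≤ M₂ :=
      (norm_nonneg (fderiv ℝ (fderiv ℝ F) (gradIter F a α g u₀ n))).trans (hM₂ _ hu)
    have hstep := hmono.norm_gradStep_sub_le hF hF' (convex_closedBall u₀ R) hM₁ hM₂ (ha n)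
      (hαt.le.trans (hα n)) (hα' n) hu (hVR n hnN) (hV n)
    set z := ‖gradIter F a α g u₀ n - V n‖ with hzdef
    have hz0 : 0 ≤ z := norm_nonneg _
    have hVV : ‖V n - V (n + 1)‖ ≤ (a n - a (n + 1)) / a (n + 1) * c₁ := by
      have h1 := hmono.mul_norm_sub_le_of_param (hanti n.le_succ) (hV n) (hV (n + 1))
      rw [div_mul_eq_mul_div, le_div_iff₀ (ha (n + 1)), mul_comm]
      exact h1.trans (mul_le_mul_of_nonneg_left (hV₁ n (by omega))
        (sub_nonneg.2 (hanti n.le_succ)))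
    have htri : ‖gradIter F a α g u₀ (n + 1) - V (n + 1)‖ ≤
        (1 - α n * a n ^ 2) * z + α n * ((M₁ + a n) * (M₂ / 2 * z ^ 2))
          + (a n - a (n + 1)) / a (n + 1) * c₁ := by
      refine le_trans ?_ (add_le_add hstep hVV)
      refine le_trans (le_of_eq ?_) (norm_add_le _ _)
      rw [gradIter]; congr 1; abel
    have han := ha n
    have hα0 : 0 < α n := hαt.trans_le (hα n)
    have hcontr : 0 ≤ 1 - α n * a n ^ 2 := by
      have h1 := (le_div_iff₀ (by positivity)).1 (hα' n)
      have h2 : a n ^ 2 ≤ (M₁ + a n) ^ 2 := pow_le_pow_left₀ han.le (by linarith) 2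
      nlinarith
    have hzsq : z ^ 2 ≤ (a n ^ 2 / lam) ^ 2 := pow_le_pow_left₀ hz0 hz 2
    have hnl : M₂ / 2 * (M₁ + a n) ≤ lam / 2 := by
      have h1 := (div_le_iff₀ hlam).1 hparam.nonlin_bound
      have h2 : M₂ / 2 * (M₁ + a n) ≤ M₂ / 2 * (M₁ + a 0) := by
        have := hanti n.zero_le
        gcongr
      linarith
    have hquad : (M₁ + a n) * (M₂ / 2 * z ^ 2) ≤ a n ^ 4 / (2 * lam) := by
      calc (M₁ + a n) * (M₂ / 2 * z ^ 2) = M₂ / 2 * (M₁ + a n) * z ^ 2 := by ring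
        _ ≤ lam / 2 * (a n ^ 2 / lam) ^ 2 := mul_le_mul hnl hzsq (sq_nonneg _) (by positivity)
        _ = a n ^ 4 / (2 * lam) := by field_simp
    have hlin := mul_le_mul_of_nonneg_left hz hcontr
    have hquad' := mul_le_mul_of_nonneg_left hquad hα0.le
    have hstepα : αt * (a n ^ 4 / (2 * lam)) ≤ α n * (a n ^ 4 / (2 * lam)) :=
      mul_le_mul_of_nonneg_right (hα n) (by positivity)
    have hid : (1 - α n * a n ^ 2) * (a n ^ 2 / lam) + α n * (a n ^ 4 / (2 * lam)) =
        a n ^ 2 / lam - α n * (a n ^ 4 / (2 * lam)) := by field_simp; ring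
    have hps := hparam.step n
    rw [mul_div_assoc] at hps
    linarith

lemma continuous_gradIter (hF : Continuous F) (hF' : Continuous (fderiv ℝ F)) (a α : ℕ → ℝ)
    (u₀ : H) (n : ℕ) : Continuous fun g => gradIter F a α g u₀ n := by
  induction n with
  | zero => exact continuous_const
  | succ n ih =>
    simp only [gradIter]
    have hA : Continuous fun g => ContinuousLinearMap.adjoint
        (fderiv ℝ F (gradIter F a α g u₀ n) + a n • ContinuousLinearMap.id ℝ H) :=
      ContinuousLinearMap.adjoint.continuous.comp ((hF'.comp ih).add continuous_const)
    have hr : Continuous fun g => F (gradIter F a α g u₀ n) + a n • gradIter F a α g u₀ n - g :=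
      ((hF.comp ih).add (ih.const_smul (a n))).sub continuous_id
    exact ih.sub ((hA.clm_apply hr).const_smul (α n))

end Iteration

/-! ### The regularization parameters -/

lemma regParam_pos {d c b : ℝ} (hd : 0 < d) (hc : 1 ≤ c) (n : ℕ) : 0 < regParam d c b n := by
  unfold regParam; positivity

lemma regParam_antitone {d c b : ℝ} (hd : 0 < d) (hc : 1 ≤ c) (hb : 0 ≤ b) :
    Antitone (regParam d c b) := fun m n hmn => by
  unfold regParam
  gcongr

lemma tendsto_regParam {d c b : ℝ} (hb : 0 < b) : Tendsto (regParam d c b) atTop (𝓝 0) := by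
  unfold regParam
  exact ((tendsto_rpow_atTop hb).comp
    (tendsto_atTop_add_const_left _ c tendsto_natCast_atTop_atTop)).const_div_atTop d

/-! ### The discrepancy principle -/

lemma IsStoppingIndex.le_of_norm_le {H : Type*} [NormedAddCommGroup H] {F : H → H} {u : ℕ → H}
    {g : H} {C₁ ζ δ : ℝ} {n N : ℕ} (hn : IsStoppingIndex F u g C₁ ζ δ n)
    (hN : ‖F (u N) - g‖ ≤ C₁ * δ ^ ζ) : n ≤ N :=
  not_lt.1 fun h => (hn.2 N h).not_ge hN

lemma existsUnique_isStoppingIndex {H : Type*} [NormedAddCommGroup H] {F : H → H} {u : ℕ → H}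
    {g : H} {C₁ ζ δ : ℝ} {N : ℕ} (hN : ‖F (u N) - g‖ ≤ C₁ * δ ^ ζ) :
    ∃! n, IsStoppingIndex F u g C₁ ζ δ n := by
  classical
  have hex : ∃ n, ‖F (u n) - g‖ ≤ C₁ * δ ^ ζ := ⟨N, hN⟩
  have hfind : IsStoppingIndex F u g C₁ ζ δ (Nat.find hex) :=
    ⟨Nat.find_spec hex, fun k hk => not_le.1 (Nat.find_min hex hk)⟩
  exact ⟨_, hfind, fun n hn =>
    le_antisymm (hn.le_of_norm_le hfind.1) (hfind.le_of_norm_le hn.1)⟩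

section Discrepancy

variable {H : Type*} [NormedAddCommGroup H] [InnerProductSpace ℝ H] {F : H → H}

/-- The a priori bound for regularized solutions with data error `δ`, obtained by comparison
with the regularized solution `W` for exact data. -/
lemma MonotoneOperator.mul_norm_le_of_noise (hmono : MonotoneOperator F) {a δ : ℝ} (ha : 0 < a)
    {V W g y : H} (hV : F V + a • V = g) (hW : F W + a • W = F y) (hg : ‖g - F y‖ ≤ δ) :
    a * ‖V‖ ≤ a * ‖y‖ + δ := by
  have h1 := hmono.mul_norm_sub_le_of_data hV hW
  have h2 := hmono.norm_le_of_solution ha hW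
  have h3 : ‖V‖ ≤ ‖V - W‖ + ‖W‖ := by simpa using norm_add_le (V - W) W
  nlinarith

variable [CompleteSpace H]

/-- The discrepancy estimate for one set of noisy data, where `s` plays the role of `δ ^ ζ`.
The index `N` is the first one at which the residual `a N * ‖V N‖` of the regularized solution
is at most `C * s`. Up to `N` the iterates follow the regularized solutions and the parameters
are not too small compared with `s`; at `N` the iterate has residual at most `(2 * C - 1) * s`,
because `a N` is of order `s` and hence the tracking error, being of order `a N ^ 2`, is
negligible. -/
lemma MonotoneOperator.exists_index_norm_residual_le (hmono : MonotoneOperator F)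
    (hF : Differentiable ℝ F) (hF' : Differentiable ℝ (fderiv ℝ F)) {y u₀ : H} {R M₁ M₂ : ℝ}
    (hM₁ : ∀ u ∈ Metric.closedBall u₀ R, ‖fderiv ℝ F u‖ ≤ M₁)
    (hM₂ : ∀ u ∈ Metric.closedBall u₀ R, ‖fderiv ℝ (fderiv ℝ F) u‖ ≤ M₂)
    {a α : ℕ → ℝ} {lam αt C : ℝ} (hC : 1 < C) (ha : ∀ n, 0 < a n) (hanti : Antitone a)
    (hlim : Tendsto a atTop (𝓝 0))
    (hparam : ParamConditions a lam M₁ (M₂ / 2) (‖y‖ * (1 + 1 / (C - 1))) αt ‖y‖)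
    (hR : a 0 ^ 2 / lam + ‖u₀‖ + ‖y‖ * ((C + 1) / (C - 1)) ≤ R) (hαt : 0 < αt)
    (hα : ∀ n, αt ≤ α n) (hα' : ∀ n, α n ≤ 2 / (a n ^ 2 + (M₁ + a n) ^ 2))
    {g : H} {V W : ℕ → H} (hV : ∀ n, F (V n) + a n • V n = g)
    (hW : ∀ n, F (W n) + a n • W n = F y) (hinit : ‖u₀ - V 0‖ ≤ a 0 ^ 2 / lam)
    {δ s w : ℝ} (hg : ‖g - F y‖ ≤ δ) (hs : 0 < s) (hδs : δ ≤ s) (hw : 0 < w)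
    (hwV : w ≤ ‖V 0‖) (hsw : C * s < a 0 * w) (hsmall : ‖y‖ * C ^ 2 * s ≤ (C - 1) * w ^ 2) :
    ∃ N, ‖F (gradIter F a α g u₀ N) - g‖ ≤ (2 * C - 1) * s ∧
      ∀ n ≤ N, ‖gradIter F a α g u₀ n - V n‖ ≤ a n ^ 2 / lam ∧
        (C - 1) * s ≤ 2 * (a n * ‖y‖) := by
  classical
  have hlam := hparam.lam_pos
  have hC1 : 0 < C - 1 := by linarith
  have hVn : ∀ n, a n * ‖V n‖ ≤ a n * ‖y‖ + δ := fun n =>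
    hmono.mul_norm_le_of_noise (ha n) (hV n) (hW n) hg
  have hex : ∃ n, a n * ‖V n‖ ≤ C * s := by
    have h1 : Tendsto (fun n => a n * ‖y‖) atTop (𝓝 0) := by simpa using hlim.mul_const ‖y‖
    obtain ⟨n, hn⟩ := (h1.eventually_lt_const (mul_pos hC1 hs)).exists
    exact ⟨n, by nlinarith [hVn n]⟩
  set N := Nat.find hex with hN
  have hNle : a N * ‖V N‖ ≤ C * s := Nat.find_spec hex
  have hlt : ∀ n < N, (C - 1) * s ≤ a n * ‖y‖ := fun n hn => by
    have h1 := not_le.1 (Nat.find_min hex hn)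
    nlinarith [hVn n]
  have hN0 : N ≠ 0 := fun h => by
    rw [h] at hNle
    have := mul_le_mul_of_nonneg_left hwV (ha 0).le
    linarith
  have hle : ∀ n ≤ N, (C - 1) * s ≤ 2 * (a n * ‖y‖) := fun n hn => by
    rcases hn.lt_or_eq with h | rfl
    · have := mul_nonneg (ha n).le (norm_nonneg y)
      linarith [hlt n h]
    · -- one step further the parameter has at most halved
      obtain ⟨k, hk⟩ := Nat.exists_eq_succ_of_ne_zero hN0
      rw [hk]
      have h1 := hlt k (by omega)
      have h2 := (div_le_iff₀ (ha (k + 1))).1 (hparam.ratio k)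
      have h3 := mul_le_mul_of_nonneg_right h2 (norm_nonneg y)
      rw [Nat.succ_eq_add_one]
      linarith
  have hV₁ : ∀ n < N, ‖V n‖ ≤ ‖y‖ * (1 + 1 / (C - 1)) := fun n hn => by
    refine le_of_mul_le_mul_left ((hVn n).trans ?_) (ha n)
    have h1 : δ ≤ a n * ‖y‖ / (C - 1) := by
      rw [le_div_iff₀ hC1]; nlinarith [hlt n hn]
    calc a n * ‖y‖ + δ ≤ a n * ‖y‖ + a n * ‖y‖ / (C - 1) := by linarith
      _ = _ := by ring
  have hVr : ∀ n ≤ N, ‖V n‖ ≤ ‖y‖ * ((C + 1) / (C - 1)) := fun n hn => by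
    refine le_of_mul_le_mul_left ((hVn n).trans ?_) (ha n)
    have h1 : δ ≤ 2 * (a n * ‖y‖) / (C - 1) := by
      rw [le_div_iff₀ hC1]; nlinarith [hle n hn]
    calc a n * ‖y‖ + δ ≤ a n * ‖y‖ + 2 * (a n * ‖y‖) / (C - 1) := by linarith
      _ = _ := by field_simp; ring
  have htrack := fun n (hn : n ≤ N) => hmono.gradIter_tracks hF hF' hM₁ hM₂ ha hanti hparam hR
    hαt hα hα' hV hinit hV₁ hVr hn
  refine ⟨N, ?_, fun n hn => ⟨(htrack n hn).1, hle n hn⟩⟩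
  obtain ⟨hz, hu, hVN⟩ := htrack N le_rfl
  have haN := ha N
  have hM₁0 : 0 ≤ M₁ := (norm_nonneg _).trans (hM₁ _ hu)
  have hVres : ‖F (V N) - g‖ ≤ C * s := by
    rw [← hV N, sub_add_cancel_left, norm_neg, norm_smul, Real.norm_of_nonneg haN.le]
    exact hNle
  have hLip : ‖F (gradIter F a α g u₀ N) - F (V N)‖ ≤ M₁ * (a N ^ 2 / lam) :=
    ((convex_closedBall u₀ R).norm_image_sub_le_of_norm_fderiv_le (fun x _ => hF x) hM₁ hVN
      hu).trans (mul_le_mul_of_nonneg_left hz hM₁0)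
  have haw : a N * w ≤ C * s := by
    have h1 := hmono.norm_le_norm_of_param_le haN (hanti N.zero_le) (hV 0) (hV N)
    exact (mul_le_mul_of_nonneg_left (hwV.trans h1) haN.le).trans hNle
  have hsq : M₁ * (a N ^ 2 / lam) ≤ (C - 1) * s := by
    have h1 : M₁ * (a N ^ 2 / lam) ≤ ‖y‖ * a N ^ 2 := by
      calc M₁ * (a N ^ 2 / lam) = M₁ / lam * a N ^ 2 := by ring
        _ ≤ _ := mul_le_mul_of_nonneg_right hparam.deriv_bound (sq_nonneg _)
    refine h1.trans (le_of_mul_le_mul_right ?_ (by positivity : 0 < w ^ 2))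
    calc ‖y‖ * a N ^ 2 * w ^ 2 = ‖y‖ * (a N * w) ^ 2 := by ring
      _ ≤ ‖y‖ * (C * s) ^ 2 := by gcongr
      _ = ‖y‖ * C ^ 2 * s * s := by ring
      _ ≤ (C - 1) * w ^ 2 * s := by gcongr
      _ = _ := by ring
  have htri := norm_sub_le_norm_sub_add_norm_sub (F (gradIter F a α g u₀ N)) (F (V N)) g
  linarith

end Discrepancy

/-! ### Stopping and convergence of the iteration -/

theorem theorem19 {H : Type*} [NormedAddCommGroup H] [InnerProductSpace ℝ H] [CompleteSpace H]
    -- the operator, the exact equation and its minimal-norm solution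
    (F : H → H) (hmono : MonotoneOperator F)
    (hF : Differentiable ℝ F) (hF' : Differentiable ℝ (fderiv ℝ F))
    (f y : H) (hy : IsMinimalNormSolution F f y) (hy0 : y ≠ 0)
    -- the discrepancy principle and the constants derived from it
    (C₁ ζ C : ℝ) (hC₁ : 1 < C₁) (hζ0 : 0 < ζ) (hζ1 : ζ ≤ 1) (hC : C = (C₁ + 1) / 2)
    -- initial guess, ball, and bounds of the derivatives on the ball
    (u₀ : H) (R M₁ M₂ c₀ c₁ : ℝ)
    (hM₁ : ∀ u ∈ Metric.closedBall u₀ R, ‖fderiv ℝ F u‖ ≤ M₁)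
    (hM₂ : ∀ u ∈ Metric.closedBall u₀ R, ‖fderiv ℝ (fderiv ℝ F) u‖ ≤ M₂)
    (hc₀ : c₀ = M₂ / 2) (hc₁ : c₁ = ‖y‖ * (1 + 1 / (C - 1)))
    -- regularization parameters and step sizes
    (b c d lam αt : ℝ) (hb0 : 0 < b) (hb : b ≤ 1 / 4) (hc : 1 ≤ c) (hd : 0 < d)
    (a : ℕ → ℝ) (ha : a = regParam d c b)
    (hparam : ParamConditions a lam M₁ c₀ c₁ αt ‖y‖)
    (hR : a 0 ^ 2 / lam + ‖u₀‖ + ‖y‖ * ((C + 1) / (C - 1)) ≤ R)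
    (α : ℕ → ℝ) (hαt : 0 < αt) (hα_ge : ∀ n, αt ≤ α n)
    (hα_le : ∀ n, α n ≤ 2 / (a n ^ 2 + (M₁ + a n) ^ 2)) :
    -- for small noise levels there is exactly one stopping index
    (∃ δ₀ : ℝ, 0 < δ₀ ∧ ∀ (δ : ℝ) (fδ : H), 0 < δ → δ < δ₀ →
      AdmissibleData F (a 0) lam f u₀ δ fδ →
      ∃! n : ℕ, IsStoppingIndex F (gradIter F a α fδ u₀) fδ C₁ ζ δ n) ∧
    -- behaviour along a sequence of noise levels tending to zero
    (∀ (δ : ℕ → ℝ) (fδ : ℕ → H) (n : ℕ → ℕ),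
      (∀ m, 0 < δ m) → Tendsto δ atTop (𝓝 0) →
      (∀ m, AdmissibleData F (a 0) lam f u₀ (δ m) (fδ m)) →
      (∀ m, IsStoppingIndex F (gradIter F a α (fδ m) u₀) (fδ m) C₁ ζ (δ m) (n m)) →
      (BddAbove (Set.range n) →
        ∀ (φ : ℕ → ℕ) (N : ℕ), StrictMono φ → Tendsto (fun j => n (φ j)) atTop (𝓝 N) →
          ∃ ut : H, F ut = f ∧
            Tendsto (fun j => gradIter F a α (fδ (φ j)) u₀ (n (φ j))) atTop (𝓝 ut)) ∧
      (Tendsto n atTop atTop → ζ < 1 →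
        Tendsto (fun m => ‖gradIter F a α (fδ m) u₀ (n m) - y‖) atTop (𝓝 0))) := by

  have hC1 : 1 < C := by linarith
  have hC1' : 0 < C - 1 := by linarith
  have hapos : ∀ n, 0 < a n := fun n => ha ▸ regParam_pos hd hc n
  have hanti : Antitone a := ha ▸ regParam_antitone hd hc hb0.le
  have halim : Tendsto a atTop (𝓝 0) := ha ▸ tendsto_regParam hb0
  have hlam := hparam.lam_pos
  have hFc : Continuous F := hF.continuous
  have hFc' : Continuous (fderiv ℝ F) := hF'.continuous
  obtain ⟨hyf, hymin⟩ := hy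
  choose V hV using fun (g : H) (n : ℕ) =>
    hmono.exists_add_smul_eq hF hFc' (hapos n) g
  have hW : ∀ n, F (V f n) + a n • V f n = F y := fun n => (hV f n).trans hyf.symm
  -- the regularized solution for exact data and the first parameter does not vanish
  have hv : 0 < ‖V f 0‖ := by
    refine norm_pos_iff.2 fun h0 => hy0 ?_
    have h1 := hV f 0
    rw [h0, smul_zero, add_zero] at h1
    simpa using hymin 0 h1
  set w := ‖V f 0‖ / 2 with hw
  have hwpos : 0 < w := by positivity
  have hpow : Tendsto (fun δ : ℝ => δ ^ ζ) (𝓝[>] 0) (𝓝 0) := by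
    have h1 := (Real.continuous_rpow_const hζ0.le).tendsto 0
    rw [Real.zero_rpow hζ0.ne'] at h1
    exact h1.mono_left nhdsWithin_le_nhds
  have key : ∃ δ₀ : ℝ, 0 < δ₀ ∧ ∀ (δ : ℝ) (g : H), 0 < δ → δ < δ₀ →
      AdmissibleData F (a 0) lam f u₀ δ g →
      ∃ N, ‖F (gradIter F a α g u₀ N) - g‖ ≤ C₁ * δ ^ ζ ∧
        ∀ n ≤ N, ‖gradIter F a α g u₀ n - V g n‖ ≤ a n ^ 2 / lam ∧
          (C - 1) * δ ^ ζ ≤ 2 * (a n * ‖y‖) := by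
    have hid : Tendsto (fun δ : ℝ => δ) (𝓝[>] 0) (𝓝 0) := tendsto_nhds_of_tendsto_nhdsWithin
      tendsto_id
    have h1 : ∀ᶠ δ : ℝ in 𝓝[>] 0, δ < 1 := hid.eventually_lt_const one_pos
    have h2 : ∀ᶠ δ : ℝ in 𝓝[>] 0, δ < a 0 * w :=
      hid.eventually_lt_const (mul_pos (hapos 0) hwpos)
    have h3 : ∀ᶠ δ : ℝ in 𝓝[>] 0, C * δ ^ ζ < a 0 * w :=
      (hpow.const_mul C).eventually_lt_const (by simpa using mul_pos (hapos 0) hwpos)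
    have h4 : ∀ᶠ δ : ℝ in 𝓝[>] 0, ‖y‖ * C ^ 2 * δ ^ ζ < (C - 1) * w ^ 2 :=
      (hpow.const_mul (‖y‖ * C ^ 2)).eventually_lt_const (by
        rw [mul_zero]; positivity)
    obtain ⟨δ₀, hδ₀, hsub⟩ := (mem_nhdsGT_iff_exists_Ioo_subset).1
      (h1.and (h2.and (h3.and h4)))
    refine ⟨δ₀, hδ₀, fun δ g hδ hδlt hadm => ?_⟩
    obtain ⟨hδ1, hδw, hsw, hsmall⟩ := hsub ⟨hδ, hδlt⟩
    have hg : ‖g - F y‖ ≤ δ := hyf.symm ▸ hadm.noise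
    have hwV : w ≤ ‖V g 0‖ := by
      have h5 := hmono.mul_norm_sub_le_of_data (hV f 0) (hV g 0)
      have h6 : ‖V f 0 - V g 0‖ ≤ w := by
        refine le_of_mul_le_mul_left (h5.trans ?_) (hapos 0)
        rw [norm_sub_rev]
        exact hadm.noise.trans hδw.le
      linarith [norm_sub_norm_le (V f 0) (V g 0)]
    have hinit : ‖u₀ - V g 0‖ ≤ a 0 ^ 2 / lam := by
      obtain ⟨V', hV', hle⟩ := hadm.init
      have h5 := hmono.mul_norm_sub_le_of_data (sub_eq_zero.1 hV') (hV g 0)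
      rw [sub_self, norm_zero] at h5
      have h6 : V' = V g 0 := sub_eq_zero.1 (norm_le_zero_iff.1
        (nonpos_of_mul_nonpos_right h5 (hapos 0)))
      have ha0 := hapos 0
      rw [← h6]
      refine hle.trans ((div_le_iff₀ ha0).2 ?_)
      rw [norm_sub_rev]
      exact hadm.size.trans (le_of_eq (by ring))
    have := hmono.exists_index_norm_residual_le hF hF' hM₁ hM₂ hC1 hapos hanti halim
      (hc₁ ▸ hc₀ ▸ hparam) hR hαt hα_ge hα_le (hV g) hW hinit hg (Real.rpow_pos_of_pos hδ ζ)
      (Real.self_le_rpow_of_le_one hδ.le hδ1.le hζ1) hwpos hwV hsw hsmall.le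
    rwa [show 2 * C - 1 = C₁ by rw [hC]; ring] at this
  obtain ⟨δ₀, hδ₀, hkey⟩ := key
  refine ⟨⟨δ₀, hδ₀, fun δ g hδ hlt hadm => ?_⟩, fun δ fδ n hδ hδlim hadm hindex => ⟨?_, ?_⟩⟩
  · obtain ⟨N, hN, -⟩ := hkey δ g hδ hlt hadm
    exact existsUnique_isStoppingIndex hN
  · intro _ φ N hφ hφN
    have hφ' : Tendsto φ atTop atTop := hφ.tendsto_atTop
    have hfδ : Tendsto (fun j => fδ (φ j)) atTop (𝓝 f) :=
      tendsto_iff_norm_sub_tendsto_zero.2 (squeeze_zero (fun _ => norm_nonneg _)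
        (fun j => (hadm (φ j)).noise) (hδlim.comp hφ'))
    have hconst : ∀ᶠ j in atTop, n (φ j) = N := by
      rw [nhds_discrete, tendsto_pure] at hφN
      exact hφN
    have hu : Tendsto (fun j => gradIter F a α (fδ (φ j)) u₀ (n (φ j))) atTop
        (𝓝 (gradIter F a α f u₀ N)) := by
      refine (((continuous_gradIter hFc hFc' a α u₀ N).tendsto f).comp hfδ).congr' ?_
      filter_upwards [hconst] with j hj
      simp [hj]
    refine ⟨_, ?_, hu⟩
    have hres : Tendsto (fun j => ‖F (gradIter F a α (fδ (φ j)) u₀ (n (φ j))) - fδ (φ j)‖) atTop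
        (𝓝 ‖F (gradIter F a α f u₀ N) - f‖) :=
      (((hFc.tendsto _).comp hu).sub hfδ).norm
    have hδφ : Tendsto (fun j => δ (φ j)) atTop (𝓝[>] 0) :=
      tendsto_nhdsWithin_iff.2 ⟨hδlim.comp hφ', Eventually.of_forall fun j => hδ (φ j)⟩
    have hbd : Tendsto (fun j => C₁ * δ (φ j) ^ ζ) atTop (𝓝 0) := by
      simpa using (hpow.comp hδφ).const_mul C₁
    exact sub_eq_zero.1 (norm_le_zero_iff.1
      (le_of_tendsto_of_tendsto' hres hbd fun j => (hindex (φ j)).1))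
  · intro hn hζ
    have hVf : Tendsto (fun m => ‖V f (n m) - y‖) atTop (𝓝 0) :=
      (tendsto_iff_norm_sub_tendsto_zero.1
        (hmono.tendsto_regularized hFc ⟨hyf, hymin⟩ hapos hanti halim (hV f))).comp hn
    have hasq : Tendsto (fun m => a (n m) ^ 2 / lam) atTop (𝓝 0) := by
      simpa using ((halim.comp hn).pow 2).div_const lam
    -- this is where `ζ < 1` makes the noise negligible compared with the parameter
    have hnoise : Tendsto (fun m => 2 * ‖y‖ / (C - 1) * δ m ^ (1 - ζ)) atTop (𝓝 0) := by
      have h1 := ((Real.continuous_rpow_const (sub_pos.2 hζ).le).tendsto 0).comp hδlim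
      rw [Real.zero_rpow (sub_pos.2 hζ).ne'] at h1
      simpa using h1.const_mul (2 * ‖y‖ / (C - 1))
    have hsum := (hasq.add hnoise).add hVf
    rw [add_zero, add_zero] at hsum
    refine squeeze_zero' (Eventually.of_forall fun _ => norm_nonneg _) ?_ hsum
    filter_upwards [hδlim.eventually_lt_const hδ₀] with m hm
    obtain ⟨N, hN, hle⟩ := hkey (δ m) (fδ m) (hδ m) hm (hadm m)
    obtain ⟨htrack, hpar⟩ := hle (n m) ((hindex m).le_of_norm_le hN)
    have hdata : ‖V (fδ m) (n m) - V f (n m)‖ ≤ 2 * ‖y‖ / (C - 1) * δ m ^ (1 - ζ) := by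
      have h1 := (hmono.mul_norm_sub_le_of_data (hV (fδ m) (n m)) (hV f (n m))).trans
        (hadm m).noise
      refine le_of_mul_le_mul_left (h1.trans ?_) (hapos (n m))
      have h2 : δ m ^ ζ * δ m ^ (1 - ζ) = δ m := by
        rw [← Real.rpow_add (hδ m)]; simp
      have h3 := mul_le_mul_of_nonneg_right hpar (Real.rpow_nonneg (hδ m).le (1 - ζ))
      rw [mul_assoc, h2] at h3
      have h4 : a (n m) * (2 * ‖y‖ / (C - 1) * δ m ^ (1 - ζ)) =
          2 * (a (n m) * ‖y‖) * δ m ^ (1 - ζ) / (C - 1) := by ring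
      rw [h4, le_div_iff₀ hC1']
      linarith
    have hsplit : gradIter F a α (fδ m) u₀ (n m) - y =
        (gradIter F a α (fδ m) u₀ (n m) - V (fδ m) (n m)) +
          (V (fδ m) (n m) - V f (n m)) + (V f (n m) - y) := by abel
    rw [hsplit]
    exact (norm_add₃_le).trans (by linarith)
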